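/- Consider $n$ pursuers in the plane and a stationary target $T\in\mathbb R^2$. Pursuer $i$ has constant speed $V_i>0$, position $z_i=(x_i,y_i)$ and heading angle $\gamma_i$, and moves as a unicycle with lateral acceleration $a_i$: $$\dot x_i=V_i\cos\gamma_i,\qquad \dot y_i=V_i\sin\gamma_i,\qquad \dot\gamma_i=a_i/V_i .$$ Let $R_i=|T-z_i|$, let the lead angle $\theta_i\in(-\pi,\pi]$ be the signed angle from the heading direction to the line of sight $T-z_i$, and let $$\tilde t_i=\frac{R_i\,\theta_i}{V_i\sin\theta_i},\qquad a_i'=\frac{2V_i^2\sin\theta_i}{R_i}$$ be the estimated time of interception (the travel time along the circular arc from the current pose to $T$; $\tilde t_i=0$ at $T$) and the lateral acceleration of that arc. The communication graph $\mathcal G$ is a static digraph on $\{1,\dots,n\}$, and an edge $(i,j)$ makes $j$ an out-neighbour of $i$. Until pursuer $i$ reaches $T$ (where it then stays), it obeys the guidance law $$a_i=0\ \text{ if } \tilde t_i<\tilde t_j \text{ for some out-neighbour } j \text{ of } i,\qquad a_i=a_i'\ \text{ if } \tilde t_i\ge\tilde t_j \text{ for all out-neighbours } j \text{ of } i .$$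 This feedback is discontinuous and may call for infinitely fast switching along equality of estimates. Trajectories are therefore understood as follows. For $\varepsilon\ge0$, a closed-loop motion with tolerance $\varepsilon$ is one with $a_i\in\{0,a_i'\}$ at all times, $a_i=a_i'$ whenever $\tilde t_i\ge\tilde t_j$ for all out-neighbours $j$, and $a_i=0$ whenever $\tilde t_i+\varepsilon<\tilde t_j$ for some out-neighbour $j$ (each $a_i$ being integrable in time and $\gamma_i(t)=\gamma_i(0)+\int_0^t a_i/V_i$); tolerance $0$ is the guidance law itself. A trajectory $(z,\gamma)$ on $[0,\infty)$ under the guidance law is a limit of closed-loop motions with the same initial poses and tolerances $\varepsilon_k\to0$, where positions converge uniformly on every $[0,t]$, and the headings of pursuer $i$ converge uniformly on every $[0,t]$ on which $z_i\ne T$. In particular every motion obeying the law exactly is a trajectory. **Theorem.** Suppose that $z_i(0)\neq T$ and $\theta_i(0)\notin\{0,\pi\}$ for all $i$. Let $l$ be a leader, i.e. $\tilde t_l(0)=\max_{1\le i\le n}\tilde t_i(0)$, and suppose that $l$ is globally reachable in $\mathcal G$, i.e. from every node there is a directed path to $l$. Then along every trajectory under the guidance law all pursuers intercept $T$ simultaneously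 at time $t_f=\tilde t_l(0)$: for every $i$, $z_i(t)\ne T$ for $0\le t<t_f$, and $z_i(t_f)=T$. -/

import Mathlib

/-!
The plane is `ℂ`.  A pursuer has a position `z`, a heading `γ` (angle from the positive real axis)
and a constant speed `V`; the stationary target is the point `T`.
-/

/-- The lead angle, in `(-π, π]`: the signed angle from the heading direction `exp (γ i)` to the
line of sight `T - z`. -/
noncomputable def leadAngle (T z : ℂ) (γ : ℝ) : ℝ :=
  Complex.arg ((T - z) * Complex.exp (-(γ * Complex.I)))

/-- The estimated time of interception `R θ / (V sin θ)`: the time needed to reach `T` along the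
circular arc that starts in the current pose. It is `0` at the target itself. -/
noncomputable def interceptTime (T : ℂ) (V : ℝ) (z : ℂ) (γ : ℝ) : ℝ :=
  ‖T - z‖ * leadAngle T z γ / (V * Real.sin (leadAngle T z γ))

/-- The lateral acceleration `2 V² sin θ / R` of the circular arc to the target. -/
noncomputable def arcAccel (T : ℂ) (V : ℝ) (z : ℂ) (γ : ℝ) : ℝ :=
  2 * V ^ 2 * Real.sin (leadAngle T z γ) / ‖T - z‖

/-- Closed-loop motions of `n` unicycles (positions `z`, headings `γ`, lateral accelerations `a`)
under the max-consensus guidance law over the static digraph `G`, where an edge `i ⟶ j` makes `j`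
an out-neighbour of `i`.  For `ε = 0` this is the guidance law itself: `a i` is zero if the
estimate of `i` is smaller than that of some out-neighbour, and the arc acceleration otherwise.
For `ε > 0` the switch from the arc back to the straight line may be delayed as long as the estimate
of `i` is less than the maximum over its out-neighbours by at most `ε`; the switch from the
straight line to the arc always happens at equality.
A pursuer obeys kinematics and guidance law until it is at the target, where it stays. -/
structure IsClosedLoop {n : ℕ} (G : Digraph (Fin n)) (T : ℂ) (V : Fin n → ℝ) (ε : ℝ)
    (z : Fin n → ℝ → ℂ) (γ a : Fin n → ℝ → ℝ) : Prop where
  continuousOn : ∀ i, ContinuousOn (z i) (Set.Ici 0)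
  stays : ∀ i s t, 0 ≤ s → s ≤ t → z i s = T → z i t = T
  position : ∀ i t, 0 ≤ t → z i t ≠ T →
    HasDerivWithinAt (z i) (⟨V i * Real.cos (γ i t), V i * Real.sin (γ i t)⟩ : ℂ) (Set.Ici 0) t
  integrable : ∀ i t, 0 ≤ t → z i t ≠ T → IntervalIntegrable (a i) MeasureTheory.volume 0 t
  heading : ∀ i t, 0 ≤ t → z i t ≠ T → γ i t = γ i 0 + ∫ s in (0 : ℝ)..t, a i s / V i
  modes : ∀ i t, 0 ≤ t → z i t ≠ T → a i t = 0 ∨ a i t = arcAccel T (V i) (z i t) (γ i t)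
  straight : ∀ i t, 0 ≤ t → z i t ≠ T →
    (∃ j, G.Adj i j ∧
      interceptTime T (V i) (z i t) (γ i t) + ε < interceptTime T (V j) (z j t) (γ j t)) →
    a i t = 0
  arc : ∀ i t, 0 ≤ t → z i t ≠ T →
    (∀ j, G.Adj i j →
      interceptTime T (V j) (z j t) (γ j t) ≤ interceptTime T (V i) (z i t) (γ i t)) →
    a i t = arcAccel T (V i) (z i t) (γ i t)

/-- Trajectories of the pursuers under the guidance law.  The feedback is discontinuous, and a
pursuer that has caught up with an out-neighbour moving on a straight line may have to switch
infinitely often in no time (sliding along equality of the estimates).  So trajectories are the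
locally uniform limits, with the initial poses fixed, of closed-loop motions whose switching delay
tends to zero.  Constant sequences with `ε = 0` give all motions that obey the law exactly. -/
def IsGuidedTrajectory {n : ℕ} (G : Digraph (Fin n)) (T : ℂ) (V : Fin n → ℝ)
    (z : Fin n → ℝ → ℂ) (γ : Fin n → ℝ → ℝ) : Prop :=
  ∃ (ε : ℕ → ℝ) (zk : ℕ → Fin n → ℝ → ℂ) (γk ak : ℕ → Fin n → ℝ → ℝ),
    (∀ k, 0 ≤ ε k) ∧ Filter.Tendsto ε Filter.atTop (nhds 0) ∧
    (∀ k, IsClosedLoop G T V (ε k) (zk k) (γk k) (ak k)) ∧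
    (∀ k i, zk k i 0 = z i 0 ∧ γk k i 0 = γ i 0) ∧
    (∀ i t, 0 ≤ t →
      TendstoUniformlyOn (fun k => zk k i) (z i) Filter.atTop (Set.Icc 0 t)) ∧
    (∀ i t, 0 ≤ t → (∀ s ∈ Set.Icc 0 t, z i s ≠ T) →
      TendstoUniformlyOn (fun k => γk k i) (γ i) Filter.atTop (Set.Icc 0 t))

/-- Node `l` is globally reachable: every node has a directed path to it. -/
def GloballyReachable {n : ℕ} (G : Digraph (Fin n)) (l : Fin n) : Prop :=
  ∀ i, Relation.ReflTransGen G.Adj i l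

/-- Pursuer `l` is a leader: its estimated time of interception is maximal in the group, which is
in the poses `z i`, `γ i`. -/
def IsLeader {n : ℕ} (T : ℂ) (V : Fin n → ℝ) (z : Fin n → ℂ) (γ : Fin n → ℝ) (l : Fin n) :
    Prop :=
  ∀ i, interceptTime T (V i) (z i) (γ i) ≤ interceptTime T (V l) (z l) (γ l)

open MeasureTheory Set Filter Topology

/-! ### Lipschitz functions on an interval and their almost everywhere derivatives -/

/-! In the body frame the target has a position ζ with ζ' = -V - iωζ, and V times the estimate is
the length of the circular arc to it. The estimate falls at rate exactly 1 on the arc; on a straight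
line its derivative is 1 - 2θ cot θ ≥ -1 (`hasDerivAt_arcLength`). A pursuer with the largest
estimate of all follows its arc, so the maximum of estimate plus elapsed time cannot grow beyond the
leader's initial value M, and every estimate is at most M - t (`interceptTime_le`). Since distance
is at most V times the estimate, everybody is at T at time M.

Early arrival is excluded by induction along paths to the leader, whose own estimate cannot fall
below M - t. If an out-neighbour j of i keeps a distance β on [0, s], s < M, its estimate is at
least β / V_j; hence, for small tolerance, i flies straight whenever its estimate is below β / (2
V_j). Such a pursuer misses T: a straight flight preserves the lateral offset ζ.im, and the bounded
arc diameter keeps that offset away from zero while the estimate is large (`diam_le`, `le_im`). The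
resulting distance does not depend on the tolerance, so it survives the limit. -/

theorem LipschitzOnWith.le_of_ae_deriv_nonneg {f : ℝ → ℝ} {K : NNReal} {a b : ℝ} (hab : a ≤ b)
    (hf : LipschitzOnWith K f (Icc a b)) (h : ∀ᵐ t, t ∈ Ioo a b → 0 ≤ deriv f t) : f a ≤ f b := by
  have hac : AbsolutelyContinuousOnInterval f a b :=
    LipschitzOnWith.absolutelyContinuousOnInterval (by rwa [uIcc_of_le hab])
  have h1 := hac.integral_deriv_eq_sub
  have h2 : 0 ≤ ∫ x in a..b, deriv f x := by
    apply intervalIntegral.integral_nonneg_of_ae_restrict hab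
    rw [← Measure.restrict_congr_set (Ioo_ae_eq_Icc (μ := volume) (a := a) (b := b))]
    exact (ae_restrict_iff' measurableSet_Ioo).2 h
  linarith

theorem LipschitzOnWith.ae_differentiableAt_Ioo {f : ℝ → ℝ} {K : NNReal} {a b : ℝ}
    (hf : LipschitzOnWith K f (Icc a b)) : ∀ᵐ t, t ∈ Ioo a b → DifferentiableAt ℝ f t := by
  rcases le_total a b with hab | hab
  · have hac : AbsolutelyContinuousOnInterval f a b :=
      LipschitzOnWith.absolutelyContinuousOnInterval (by rwa [uIcc_of_le hab])
    filter_upwards [hac.ae_differentiableAt] with t ht hm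
    exact ht (by rw [uIcc_of_le hab]; exact Ioo_subset_Icc_self hm)
  · simp [Ioo_eq_empty_of_le hab]

/-- A Lipschitz function that is nondecreasing wherever it is below the level `c` stays above `c`
if it starts above `c`. -/
theorem LipschitzOnWith.le_of_ae_deriv_nonneg_below {f : ℝ → ℝ} {K : NNReal} {a b c : ℝ}
    (hf : LipschitzOnWith K f (Icc a b))
    (h : ∀ᵐ t, t ∈ Ioo a b → f t < c → 0 ≤ deriv f t) (ha : c ≤ f a) :
    ∀ t ∈ Icc a b, c ≤ f t := by
  intro t ht
  have hsub : Icc a t ⊆ Icc a b := Icc_subset_Icc_right ht.2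
  -- The truncation at `c` is nondecreasing: it coincides with `f` near points where `f < c`, and
  -- has a local maximum, hence zero derivative, elsewhere.
  have hg : LipschitzOnWith K (fun x => min c (f x)) (Icc a t) := by
    apply LipschitzOnWith.of_le_add_mul
    intro x hx y hy
    have h1 := (hf.mono hsub).le_add_mul hx hy
    have h2 : 0 ≤ (K : ℝ) * dist x y := by positivity
    rcases le_total c (f y) with h3 | h3
    · rw [min_eq_left h3]
      exact (min_le_left _ _).trans (by linarith)
    · rw [min_eq_right h3]
      exact (min_le_right _ _).trans h1
  have key := hg.le_of_ae_deriv_nonneg ht.1 (by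
    filter_upwards [h] with x hx hxt
    have hxb : x ∈ Ioo a b := ⟨hxt.1, hxt.2.trans_le ht.2⟩
    rcases lt_or_ge (f x) c with h3 | h3
    · have hcont : ContinuousAt f x := hf.continuousOn.continuousAt (Icc_mem_nhds hxb.1 hxb.2)
      have heq : (fun x => min c (f x)) =ᶠ[𝓝 x] f := by
        filter_upwards [hcont.eventually_lt_const h3] with y hy
        exact min_eq_right hy.le
      rw [heq.deriv_eq]
      exact hx hxb h3
    · have hmax : IsLocalMax (fun x => min c (f x)) x := by
        refine Eventually.of_forall fun y => ?_
        simp only [min_eq_left h3]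
        exact min_le_left _ _
      rw [hmax.deriv_eq_zero])
  simp only [min_eq_left ha] at key
  exact key.trans (min_le_right _ _)

/-- A finite family of Lipschitz functions stays below the level `c` if, above that level, the
largest one never increases. -/
theorem LipschitzOnWith.forall_le_of_ae_deriv_nonpos {ι : Type*} [Fintype ι] {D : ι → ℝ → ℝ}
    {K : ι → NNReal} {a b c : ℝ} (hab : a ≤ b) (hD : ∀ i, LipschitzOnWith (K i) (D i) (Icc a b))
    (h : ∀ᵐ t, t ∈ Ioo a b → ∀ i, c < D i t → (∀ j, D j t ≤ D i t) → deriv (D i) t ≤ 0)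
    (ha : ∀ i, D i a ≤ c) (i : ι) : D i b ≤ c := by
  classical
  -- The level `c` joins the family as the member `none`, so that bounding the maximum `m` suffices.
  let E : Option ι → ℝ → ℝ := fun o => o.elim (fun _ => c) D
  let m : ℝ → ℝ := fun t => Finset.univ.sup' Finset.univ_nonempty fun o => E o t
  have hEm : ∀ o t, E o t ≤ m t := fun o t =>
    Finset.le_sup' (fun o => E o t) (Finset.mem_univ o)
  let L : NNReal := ∑ i, K i
  have hm : LipschitzOnWith L m (Icc a b) := by
    apply LipschitzOnWith.of_le_add_mul
    intro x hx y hy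
    refine Finset.sup'_le _ _ fun o _ => ?_
    rcases o with _ | j
    · have : 0 ≤ (L : ℝ) * dist x y := by positivity
      have := hEm none y
      simp only [E, Option.elim] at this ⊢
      linarith
    · have h1 := (hD j).le_add_mul hx hy
      have h2 := hEm (some j) y
      have h3 : K j ≤ L := Finset.single_le_sum (f := K) (fun _ _ => zero_le) (Finset.mem_univ j)
      have h4 : (K j : ℝ) * dist x y ≤ L * dist x y := by gcongr
      simp only [E, Option.elim] at h2 ⊢
      linarith
  have key : LipschitzOnWith L (fun t => -m t) (Icc a b) := by
    apply LipschitzOnWith.of_le_add_mul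
    intro x hx y hy
    have := hm.le_add_mul hy hx
    rw [dist_comm] at this
    linarith
  have h1 := key.le_of_ae_deriv_nonneg hab (by
    have hdiff : ∀ᵐ t, ∀ i, t ∈ Ioo a b → DifferentiableAt ℝ (D i) t :=
      ae_all_iff.2 fun i => (hD i).ae_differentiableAt_Ioo
    filter_upwards [h, hdiff, hm.ae_differentiableAt_Ioo] with t ht hdt hmt htI
    rw [deriv.fun_neg]
    obtain ⟨o, -, ho⟩ := Finset.exists_mem_eq_sup' Finset.univ_nonempty fun o => E o t
    change m t = E o t at ho
    have hE : DifferentiableAt ℝ (E o) t := by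
      rcases o with _ | j
      · exact differentiableAt_const _
      · exact hdt j htI
    -- The maximum touches the member attaining it from above, so at a point of differentiability
    -- both have the same derivative.
    have hmin : IsLocalMin (fun s => m s - E o s) t := by
      refine Eventually.of_forall fun s => ?_
      have := hEm o s
      simp only
      linarith
    have h0 := hmin.deriv_eq_zero
    rw [deriv_fun_sub (hmt htI) hE] at h0
    suffices deriv (E o) t ≤ 0 by linarith
    rcases o with _ | j
    · exact (deriv_const t c).le
    · rcases lt_or_ge c (D j t) with hc | hc
      · exact ht htI j hc fun k => (hEm (some k) t).trans ho.le
      · have hmin' : IsLocalMin m t := by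
          refine Eventually.of_forall fun s => ?_
          exact (ho.trans_le hc).trans (hEm none s)
        have := hmin'.deriv_eq_zero
        linarith)
  have h2 : m a ≤ c := by
    refine Finset.sup'_le _ _ fun o _ => ?_
    rcases o with _ | j
    · exact le_rfl
    · exact ha j
  have h3 : D i b ≤ m b := hEm (some i) b
  linarith

/-- A continuously differentiable function of a Lipschitz curve is Lipschitz. -/
theorem LipschitzOnWith.exists_comp_contDiffAt {E : Type*} [NormedAddCommGroup E]
    [NormedSpace ℝ E] {E' : Type*} [NormedAddCommGroup E'] [NormedSpace ℝ E'] {ζ : ℝ → E}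
    {F : E → E'} {K : NNReal} {a b : ℝ}
    (hζ : LipschitzOnWith K ζ (Icc a b)) (hF : ∀ t ∈ Icc a b, ContDiffAt ℝ 1 F (ζ t)) :
    ∃ L, LipschitzOnWith L (fun t => F (ζ t)) (Icc a b) := by
  apply LocallyLipschitzOn.exists_lipschitzOnWith_of_compact isCompact_Icc
  intro t ht
  obtain ⟨L, U, hU, hL⟩ := (hF t ht).exists_lipschitzOnWith
  refine ⟨L * K, ζ ⁻¹' U ∩ Icc a b, ?_, ?_⟩
  · exact inter_mem (hζ.continuousOn t ht hU) self_mem_nhdsWithin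
  · exact hL.comp (hζ.mono inter_subset_right) fun x hx => hx.1

/-! ### A single pursuer in its body frame -/

/-- The motion of a pursuer of speed `V` on `[0, s]`, in terms of the position `ζ` of the target
relative to the pursuer, in coordinates with the first axis along the heading, and of the turn rate
`ω`, which is zero or that of the circular arc to the target. -/
structure IsArcOrLine (V s : ℝ) (ζ : ℝ → ℂ) (ω : ℝ → ℝ) : Prop where
  speed_pos : 0 < V
  lipschitz : ∃ K, LipschitzOnWith K ζ (Icc 0 s)
  ne_zero : ∀ t ∈ Icc 0 s, ζ t ≠ 0
  hasDerivAt : ∀ᵐ t, t ∈ Ioo 0 s → HasDerivAt ζ (-V - Complex.I * ω t * ζ t) t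
  modes : ∀ t ∈ Icc 0 s, ω t = 0 ∨ ω t = 2 * V * (ζ t).im / ‖ζ t‖ ^ 2

/-- The length of the circular arc that starts at the origin in the direction of the positive real
axis and ends at `ζ`. -/
noncomputable def arcLength (ζ : ℂ) : ℝ := ‖ζ‖ ^ 2 / ζ.im * ζ.arg

theorem contDiffAt_normSq_div_im {ζ : ℂ} (h : 0 < ζ.im) :
    ContDiffAt ℝ 1 (fun x : ℂ => ‖x‖ ^ 2 / x.im) ζ := by
  have h1 : ContDiffAt ℝ 1 (fun x : ℂ => x.im) ζ := Complex.imCLM.contDiff.contDiffAt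
  exact (contDiff_norm_sq ℝ).contDiffAt.div h1 h.ne'

theorem contDiffAt_arcLength {ζ : ℂ} (h : 0 < ζ.im) : ContDiffAt ℝ 1 arcLength ζ := by
  have h2 : ContDiffAt ℝ 1 Complex.arg ζ := by
    have h3 : ContDiffAt ℝ 1 Complex.log ζ :=
      (Complex.contDiffAt_log (Complex.mem_slitPlane_iff.2 (Or.inr h.ne'))).restrict_scalars ℝ
    exact (Complex.imCLM.contDiff.contDiffAt.comp ζ h3).congr_of_eventuallyEq
      (Eventually.of_forall fun x => (Complex.log_im x).symm)
  exact (contDiffAt_normSq_div_im h).mul h2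

theorem arg_pos_of_im_pos {ζ : ℂ} (h : 0 < ζ.im) : 0 < ζ.arg := by
  refine lt_of_le_of_ne (Complex.arg_nonneg_iff.2 h.le) fun h0 => ?_
  exact h.ne' (Complex.arg_eq_zero_iff.1 h0.symm).2

/-- This is θ ≤ tan θ below π/2; for a nonpositive real part the signs suffice. It bounds the rate
of the estimate on straight lines. -/
theorem arg_mul_re_le_im {ζ : ℂ} (h : 0 < ζ.im) : ζ.arg * ζ.re ≤ ζ.im := by
  have h0 := arg_pos_of_im_pos h
  rcases le_or_gt ζ.re 0 with hr | hr
  · nlinarith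
  · have h1 : |ζ.arg| < Real.pi / 2 := Complex.abs_arg_lt_pi_div_two_iff.2 (Or.inl hr)
    have h2 := Real.le_tan h0.le (lt_of_abs_lt h1)
    rwa [Complex.tan_arg, le_div_iff₀ hr] at h2

theorem norm_le_arcLength {ζ : ℂ} (h : 0 < ζ.im) : ‖ζ‖ ≤ arcLength ζ := by
  have hz : 0 < ‖ζ‖ := norm_pos_iff.2 fun h0 => by simp [h0] at h
  have h1 : ζ.im / ‖ζ‖ ≤ ζ.arg := by
    rw [← Complex.sin_arg]
    exact Real.sin_le (arg_pos_of_im_pos h).le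
  rw [div_le_iff₀ hz] at h1
  rw [arcLength, div_mul_eq_mul_div, le_div_iff₀ h]
  nlinarith

/-- Jordan's inequality sin θ ≥ 2θ/π on [0, π/2]: with the target ahead, a long arc means a distant
target. -/
theorem arcLength_le_of_re_nonneg {ζ : ℂ} (h : 0 < ζ.im) (hr : 0 ≤ ζ.re) :
    arcLength ζ ≤ ‖ζ‖ * (Real.pi / 2) := by
  have hz : 0 < ‖ζ‖ := norm_pos_iff.2 fun h0 => by simp [h0] at h
  have h1 : ζ.arg ≤ Real.pi / 2 := le_of_abs_le (Complex.abs_arg_le_pi_div_two_iff.2 hr)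
  have h2 := Real.mul_le_sin (arg_pos_of_im_pos h).le h1
  rw [Complex.sin_arg, le_div_iff₀ hz, div_mul_eq_mul_div, div_mul_eq_mul_div,
    div_le_iff₀ Real.pi_pos] at h2
  rw [arcLength, div_mul_eq_mul_div, div_le_iff₀ h]
  nlinarith

/-! ### Evolution of the side, arc length and arc diameter in the body frame -/

namespace IsArcOrLine

variable {V s : ℝ} {ζ : ℝ → ℂ} {ω : ℝ → ℝ}

theorem conj (h : IsArcOrLine V s ζ ω) :
    IsArcOrLine V s (fun t => (starRingEnd ℂ) (ζ t)) (fun t => -ω t) where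
  speed_pos := h.speed_pos
  lipschitz := by
    obtain ⟨K, hK⟩ := h.lipschitz
    refine ⟨K, LipschitzOnWith.of_dist_le_mul fun x hx y hy => ?_⟩
    rw [Complex.dist_conj_conj]
    exact hK.dist_le_mul x hx y hy
  ne_zero t ht := by simpa using h.ne_zero t ht
  hasDerivAt := by
    filter_upwards [h.hasDerivAt] with t ht htI
    have := (Complex.conjCLE : ℂ →L[ℝ] ℂ).hasFDerivAt.comp_hasDerivAt t (ht htI)
    refine HasDerivAt.congr_deriv (f := fun t => (starRingEnd ℂ) (ζ t)) this ?_
    simp [sub_eq_add_neg]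
  modes t ht := by
    rcases h.modes t ht with h1 | h1
    · left; simp [h1]
    · right
      rw [h1]
      simp [neg_div]

theorem hasDerivAt_re_im (h : IsArcOrLine V s ζ ω) : ∀ᵐ t, t ∈ Ioo 0 s →
    HasDerivAt (fun t => (ζ t).re) (-V + ω t * (ζ t).im) t ∧
      HasDerivAt (fun t => (ζ t).im) (-(ω t * (ζ t).re)) t := by
  filter_upwards [h.hasDerivAt] with t ht htI
  have h1 := Complex.reCLM.hasFDerivAt.comp_hasDerivAt t (ht htI)
  have h2 := Complex.imCLM.hasFDerivAt.comp_hasDerivAt t (ht htI)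
  refine ⟨HasDerivAt.congr_deriv (f := fun t => (ζ t).re) h1 ?_,
    HasDerivAt.congr_deriv (f := fun t => (ζ t).im) h2 ?_⟩ <;> simp

theorem normSq_eq (z : ℂ) : ‖z‖ ^ 2 = z.re ^ 2 + z.im ^ 2 := by
  rw [← Complex.normSq_eq_norm_sq, Complex.normSq_apply]; ring

/-- The target cannot change sides: on the compact interval the distance is at least some r > 0, so
the offset decays at most exponentially, at rate 2V/r. -/
theorem im_pos (h : IsArcOrLine V s ζ ω) (h0 : 0 < (ζ 0).im) : ∀ t ∈ Icc 0 s, 0 < (ζ t).im := by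
  intro t ht
  obtain ⟨K, hK⟩ := h.lipschitz
  have hcont := hK.continuousOn
  obtain ⟨r, hr, hrle⟩ : ∃ r, 0 < r ∧ ∀ t ∈ Icc 0 s, r ≤ ‖ζ t‖ := by
    obtain ⟨x, hx, hmin⟩ := isCompact_Icc.exists_isMinOn ⟨t, ht⟩ hcont.norm
    exact ⟨‖ζ x‖, norm_pos_iff.2 (h.ne_zero x hx), fun y hy => hmin hy⟩
  set C := 2 * V / r with hC
  have hV := h.speed_pos
  -- Squaring the offset makes the differential inequality independent of its sign, which is not yet
  -- known.
  let g : ℝ → ℝ := fun t => (ζ t).im ^ 2 * Real.exp (2 * C * t)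
  obtain ⟨L, hL⟩ : ∃ L, LipschitzOnWith L g (Icc 0 s) := by
    have hpair : LipschitzOnWith (max K 1) (fun t => (ζ t, t)) (Icc 0 s) :=
      hK.prodMk (LipschitzWith.id.lipschitzOnWith)
    refine hpair.exists_comp_contDiffAt (F := fun x => x.1.im ^ 2 * Real.exp (2 * C * x.2))
      fun t _ => ContDiff.contDiffAt ?_
    have h1 : ContDiff ℝ 1 (fun x : ℂ × ℝ => x.1.im) := Complex.imCLM.contDiff.comp contDiff_fst
    exact (h1.pow 2).mul (Real.contDiff_exp.comp (contDiff_const.mul contDiff_snd))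
  have hmono : ∀ t ∈ Icc 0 s, g 0 ≤ g t := by
    refine hL.le_of_ae_deriv_nonneg_below ?_ le_rfl
    filter_upwards [h.hasDerivAt_re_im] with x hx hxI _
    have hxI' := Ioo_subset_Icc_self hxI
    have hd : HasDerivAt g _ x :=
      ((hx hxI).2.pow 2).mul (((hasDerivAt_id x).const_mul (2 * C)).exp)
    rw [hd.deriv]
    have hz : 0 < ‖ζ x‖ := norm_pos_iff.2 (h.ne_zero x hxI')
    have hkey : (ζ x).im * (ω x * (ζ x).re) ≤ C * (ζ x).im ^ 2 := by
      rcases h.modes x hxI' with h1 | h1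
      · rw [h1]
        have : 0 ≤ C * (ζ x).im ^ 2 := by positivity
        simpa using this
      · have h2 : 2 * V * (ζ x).re / ‖ζ x‖ ^ 2 ≤ C := by
          rw [hC, div_le_div_iff₀ (by positivity) hr]
          have h3 := Complex.re_le_norm (ζ x)
          have h4 := hrle x hxI'
          have h5 : (ζ x).re * r ≤ ‖ζ x‖ ^ 2 := by nlinarith
          nlinarith
        calc (ζ x).im * (ω x * (ζ x).re)
            = 2 * V * (ζ x).re / ‖ζ x‖ ^ 2 * (ζ x).im ^ 2 := by rw [h1]; ring
          _ ≤ _ := by gcongr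
    have he := Real.exp_pos (2 * C * x)
    simp only [Pi.pow_apply, id_eq, Nat.cast_ofNat, Nat.add_one_sub_one, pow_one, mul_one]
    nlinarith
  have h1 : ∀ t ∈ Icc 0 s, (ζ t).im ≠ 0 := by
    intro x hx h2
    have := hmono x hx
    simp only [g, h2] at this
    simp at this
    nlinarith [pow_pos h0 2]
  by_contra hneg
  push Not at hneg
  have himc : ContinuousOn (fun t => (ζ t).im) (Icc 0 t) :=
    (Complex.continuous_im.comp_continuousOn hcont).mono (Icc_subset_Icc_right ht.2)
  obtain ⟨x, hx, hx0⟩ := intermediate_value_Icc' ht.1 himc ⟨hneg, h0.le⟩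
  exact h1 x (Icc_subset_Icc_right ht.2 hx) hx0

theorem exists_lipschitz_arcLength (h : IsArcOrLine V s ζ ω) (h0 : 0 < (ζ 0).im) :
    ∃ L, LipschitzOnWith L (fun t => arcLength (ζ t)) (Icc 0 s) := by
  obtain ⟨K, hK⟩ := h.lipschitz
  exact hK.exists_comp_contDiffAt fun t ht => contDiffAt_arcLength (h.im_pos h0 t ht)

/-- The numerator vanishes on the arc, and on a line it is negative as soon as the target lies
ahead. -/
theorem hasDerivAt_diam (h : IsArcOrLine V s ζ ω) (h0 : 0 < (ζ 0).im) : ∀ᵐ t, t ∈ Ioo 0 s →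
    HasDerivAt (fun t => ‖ζ t‖ ^ 2 / (ζ t).im)
      ((-2 * V * (ζ t).re * (ζ t).im + ‖ζ t‖ ^ 2 * (ω t * (ζ t).re)) / (ζ t).im ^ 2) t := by
  filter_upwards [h.hasDerivAt_re_im] with t ht htI
  obtain ⟨hre, him⟩ := ht htI
  have hq := h.im_pos h0 t (Ioo_subset_Icc_self htI)
  have h1 : HasDerivAt (fun t => ‖ζ t‖ ^ 2) (-2 * V * (ζ t).re) t := by
    have := (hre.pow 2).add (him.pow 2)
    refine (this.congr_of_eventuallyEq (Eventually.of_forall fun x => ?_)).congr_deriv ?_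
    · simp [normSq_eq]
    · simp; ring
  refine (h1.div him hq.ne').congr_deriv ?_
  ring

theorem hasDerivAt_arcLength (h : IsArcOrLine V s ζ ω) (h0 : 0 < (ζ 0).im) :
    ∀ᵐ t, t ∈ Ioo 0 s → ∃ d, HasDerivAt (fun t => arcLength (ζ t)) d t ∧ -V ≤ d ∧
      (ω t = 2 * V * (ζ t).im / ‖ζ t‖ ^ 2 → d = -V) := by
  filter_upwards [h.hasDerivAt, h.hasDerivAt_diam h0] with t ht hdiam htI
  have htI' := Ioo_subset_Icc_self htI
  have hq := h.im_pos h0 t htI'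
  have hV := h.speed_pos
  have hz : 0 < ‖ζ t‖ := norm_pos_iff.2 (h.ne_zero t htI')
  have harg : HasDerivAt (fun t => (ζ t).arg) (V * (ζ t).im / ‖ζ t‖ ^ 2 - ω t) t := by
    have h1 := (ht htI).clog_real (Complex.mem_slitPlane_iff.2 (Or.inr hq.ne'))
    have h2 := Complex.imCLM.hasFDerivAt.comp_hasDerivAt t h1
    refine (h2.congr_of_eventuallyEq
      (Eventually.of_forall fun x => (Complex.log_im _).symm)).congr_deriv ?_
    rw [sub_div, mul_div_assoc, div_self (h.ne_zero t htI')]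
    simp [Complex.div_im, Complex.normSq_eq_norm_sq]
    ring
  refine ⟨_, (hdiam htI).mul harg, ?_, ?_⟩
  all_goals
    have hfin : ω t = 2 * V * (ζ t).im / ‖ζ t‖ ^ 2 →
        (-2 * V * (ζ t).re * (ζ t).im + ‖ζ t‖ ^ 2 * (ω t * (ζ t).re)) / (ζ t).im ^ 2 * (ζ t).arg +
        ‖ζ t‖ ^ 2 / (ζ t).im * (V * (ζ t).im / ‖ζ t‖ ^ 2 - ω t) = -V := by
      intro hω
      rw [hω]
      field_simp
      ring
  · rcases h.modes t htI' with hω | hω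
    · rw [hω]
      have h3 := arg_mul_re_le_im hq
      have h4 : (-2 * V * (ζ t).re * (ζ t).im + ‖ζ t‖ ^ 2 * (0 * (ζ t).re)) / (ζ t).im ^ 2 *
          (ζ t).arg + ‖ζ t‖ ^ 2 / (ζ t).im * (V * (ζ t).im / ‖ζ t‖ ^ 2 - 0)
          = V - 2 * V * ((ζ t).arg * (ζ t).re / (ζ t).im) := by
        field_simp
        ring
      rw [h4]
      have h5 : (ζ t).arg * (ζ t).re / (ζ t).im ≤ 1 := (div_le_one hq).2 h3
      nlinarith
    · exact (hfin hω).ge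
  · exact hfin

/-- The estimated time of interception decreases at most as fast as time passes. -/
theorem arcLength_add_le (h : IsArcOrLine V s ζ ω) (h0 : 0 < (ζ 0).im) (hs : 0 ≤ s) :
    arcLength (ζ 0) ≤ arcLength (ζ s) + V * s := by
  obtain ⟨L, hL⟩ := h.exists_lipschitz_arcLength h0
  have hV := h.speed_pos
  have hlip : LipschitzOnWith (L + V.toNNReal) (fun t => arcLength (ζ t) + V * t) (Icc 0 s) := by
    refine hL.add (LipschitzOnWith.of_dist_le_mul fun x _ y _ => ?_)
    rw [Real.coe_toNNReal _ hV.le, Real.dist_eq, Real.dist_eq, ← mul_sub, abs_mul, abs_of_pos hV]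
  have := hlip.le_of_ae_deriv_nonneg hs (by
    filter_upwards [h.hasDerivAt_arcLength h0] with t ht htI
    obtain ⟨d, hd, hd1, -⟩ := ht htI
    have hd' := hd.add ((hasDerivAt_id t).const_mul V)
    rw [HasDerivAt.deriv (f := fun t => arcLength (ζ t) + V * t) hd']
    linarith)
  simpa using this

/-- The diameter of the circular arc to the target stays bounded if the estimate does. -/
theorem diam_le (h : IsArcOrLine V s ζ ω) (h0 : 0 < (ζ 0).im) {M W : ℝ}
    (hM : ∀ t ∈ Icc 0 s, arcLength (ζ t) ≤ V * M) (hW : ‖ζ 0‖ ^ 2 / (ζ 0).im ≤ W)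
    (hMW : 2 * V * M / Real.pi ≤ W) : ∀ t ∈ Icc 0 s, ‖ζ t‖ ^ 2 / (ζ t).im ≤ W := by
  obtain ⟨K, hK⟩ := h.lipschitz
  obtain ⟨L, hL⟩ := hK.exists_comp_contDiffAt
    fun t ht => (contDiffAt_normSq_div_im (h.im_pos h0 t ht)).neg
  have hV := h.speed_pos
  have key := hL.le_of_ae_deriv_nonneg_below (c := -W) (by
    filter_upwards [h.hasDerivAt_diam h0] with t ht htI hlt
    have htI' := Ioo_subset_Icc_self htI
    have hq := h.im_pos h0 t htI'
    have hz : 0 < ‖ζ t‖ := norm_pos_iff.2 (h.ne_zero t htI')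
    rw [(ht htI).fun_neg.deriv]
    rw [neg_lt_neg_iff] at hlt
    -- If θ ≥ π/2, the arc is at least π/2 times the diameter, so a diameter above 2VM/π would
    -- contradict the bound on the arc length.
    have hre : 0 < (ζ t).re := by
      have harg0 := arg_pos_of_im_pos hq
      have h1 := hM t htI'
      have h2 : 2 * V * M / Real.pi < ‖ζ t‖ ^ 2 / (ζ t).im := hMW.trans_lt hlt
      have h3 : (ζ t).arg < Real.pi / 2 := by
        by_contra hcon
        push Not at hcon
        rw [div_lt_iff₀ Real.pi_pos] at h2
        have h4 : ‖ζ t‖ ^ 2 / (ζ t).im * (Real.pi / 2) ≤ arcLength (ζ t) := by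
          rw [arcLength]; gcongr
        linarith
      rcases Complex.abs_arg_lt_pi_div_two_iff.1 (abs_lt.2 ⟨by linarith [Real.pi_pos], h3⟩) with
        h4 | h4
      · exact h4
      · exact absurd h4 (h.ne_zero t htI')
    rw [neg_nonneg]
    refine div_nonpos_of_nonpos_of_nonneg ?_ (by positivity)
    rcases h.modes t htI' with hω | hω
    · rw [hω]
      have : 0 < V * (ζ t).re * (ζ t).im := by positivity
      nlinarith
    · rw [hω]
      have : ‖ζ t‖ ^ 2 * (2 * V * (ζ t).im / ‖ζ t‖ ^ 2 * (ζ t).re) =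
        2 * V * (ζ t).re * (ζ t).im := by field_simp
      rw [this]
      linarith) (neg_le_neg hW)
  exact fun t ht => neg_le_neg_iff.1 (key t ht)

/-- A pursuer that moves on a straight line whenever its estimate is small keeps off the
target. -/
theorem le_im (h : IsArcOrLine V s ζ ω) (h0 : 0 < (ζ 0).im) {M W c β : ℝ} (hc : 0 ≤ c)
    (hM : ∀ t ∈ Icc 0 s, arcLength (ζ t) ≤ V * M) (hW : ‖ζ 0‖ ^ 2 / (ζ 0).im ≤ W)
    (hMW : 2 * V * M / Real.pi ≤ W)
    (hline : ∀ t ∈ Icc 0 s, arcLength (ζ t) < V * c → ω t = 0)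
    (hβ : β ≤ (2 * V * c / Real.pi) ^ 2 / W) (hβ0 : β ≤ (ζ 0).im) :
    ∀ t ∈ Icc 0 s, β ≤ (ζ t).im := by
  obtain ⟨K, hK⟩ := h.lipschitz
  obtain ⟨L, hL⟩ := hK.exists_comp_contDiffAt (F := Complex.im)
    fun t ht => Complex.imCLM.contDiff.contDiffAt
  have hV := h.speed_pos
  refine hL.le_of_ae_deriv_nonneg_below ?_ hβ0
  filter_upwards [h.hasDerivAt_re_im] with t ht htI hlt
  have htI' := Ioo_subset_Icc_self htI
  have hq := h.im_pos h0 t htI'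
  have hz : 0 < ‖ζ t‖ := norm_pos_iff.2 (h.ne_zero t htI')
  rw [(ht htI).2.deriv]
  rcases h.modes t htI' with hω | hω
  · simp [hω]
  -- While turning towards a target that is not ahead, the offset cannot decrease.
  rcases le_or_gt (ζ t).re 0 with hre | hre
  · have : 0 ≤ ω t := by rw [hω]; positivity
    nlinarith
  by_cases hsmall : arcLength (ζ t) < V * c
  · simp [hline t htI' hsmall]
  -- The remaining case is an arc with the target ahead and a large estimate: then the distance is
  -- at least 2Vc/π, and the diameter bound puts the offset above β, against `hlt`.
  exfalso
  push Not at hsmall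
  have h1 := hsmall.trans (arcLength_le_of_re_nonneg hq hre.le)
  have h2 : 2 * V * c / Real.pi ≤ ‖ζ t‖ := by
    rw [div_le_iff₀ Real.pi_pos]; linarith
  have h3 := h.diam_le h0 hM hW hMW t htI'
  have hWpos : 0 < W := lt_of_lt_of_le (by positivity) h3
  rw [div_le_iff₀ hq] at h3
  have h4 : (2 * V * c / Real.pi) ^ 2 ≤ ‖ζ t‖ ^ 2 := by
    have := Real.pi_pos
    gcongr
  have h5 : (2 * V * c / Real.pi) ^ 2 / W ≤ (ζ t).im := by
    rw [div_le_iff₀ hWpos]; linarith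
  linarith

end IsArcOrLine

/-! ### Closed-loop motions -/

/-- The position of the target relative to a pursuer, in coordinates with the first axis along the
heading of the pursuer. -/
noncomputable def bodyFrame (T z : ℂ) (γ : ℝ) : ℂ := (T - z) * Complex.exp (-(γ * Complex.I))

theorem norm_bodyFrame (T z : ℂ) (γ : ℝ) : ‖bodyFrame T z γ‖ = ‖T - z‖ := by
  rw [bodyFrame, norm_mul, ← neg_mul, ← Complex.ofReal_neg, Complex.norm_exp_ofReal_mul_I, mul_one]

theorem contDiff_bodyFrame (T : ℂ) : ContDiff ℝ 1 fun x : ℂ × ℝ => bodyFrame T x.1 x.2 := by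
  have h1 : ContDiff ℝ 1 fun x : ℂ × ℝ => (x.2 : ℂ) := Complex.ofRealCLM.contDiff.comp contDiff_snd
  exact (contDiff_const.sub contDiff_fst).mul (h1.mul contDiff_const).neg.cexp

theorem bodyFrame_ne_zero {T z : ℂ} (γ : ℝ) (h : z ≠ T) : bodyFrame T z γ ≠ 0 := by
  rw [← norm_pos_iff, norm_bodyFrame, norm_pos_iff]
  exact sub_ne_zero.2 h.symm

theorem interceptTime_eq {T z : ℂ} (V γ : ℝ) (h : z ≠ T) :
    interceptTime T V z γ = arcLength (bodyFrame T z γ) / V := by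
  have hz := norm_pos_iff.2 (bodyFrame_ne_zero γ h)
  rw [interceptTime, ← norm_bodyFrame T z γ]
  change _ * (bodyFrame T z γ).arg / (V * Real.sin (bodyFrame T z γ).arg) = _
  rw [Complex.sin_arg, arcLength]
  field_simp

theorem interceptTime_target (T : ℂ) (V γ : ℝ) : interceptTime T V T γ = 0 := by
  simp [interceptTime]

theorem arcAccel_eq (T z : ℂ) (V γ : ℝ) :
    arcAccel T V z γ = 2 * V ^ 2 * (bodyFrame T z γ).im / ‖bodyFrame T z γ‖ ^ 2 := by
  rw [arcAccel, ← norm_bodyFrame T z γ]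
  change _ * Real.sin (bodyFrame T z γ).arg / _ = _
  rw [Complex.sin_arg]
  ring

theorem im_bodyFrame_ne_zero {T z : ℂ} {γ : ℝ}
    (hθ : leadAngle T z γ ≠ 0 ∧ leadAngle T z γ ≠ Real.pi) : (bodyFrame T z γ).im ≠ 0 := by
  intro h0
  rcases le_or_gt 0 (bodyFrame T z γ).re with hr | hr
  · exact hθ.1 (Complex.arg_eq_zero_iff.2 ⟨hr, h0⟩)
  · exact hθ.2 (Complex.arg_eq_pi_iff.2 ⟨hr, h0⟩)

theorem arcLength_conj {ζ : ℂ} (h : ζ.im ≠ 0) : arcLength ((starRingEnd ℂ) ζ) = arcLength ζ := by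
  have hne : ζ.arg ≠ Real.pi := fun h1 => h (Complex.arg_eq_pi_iff.1 h1).2
  rw [arcLength, arcLength, Complex.arg_conj, if_neg hne]
  simp [div_neg]

namespace IsClosedLoop

variable {n : ℕ} {G : Digraph (Fin n)} {T : ℂ} {V : Fin n → ℝ} {ε : ℝ} {z : Fin n → ℝ → ℂ}
  {γ a : Fin n → ℝ → ℝ} {i : Fin n} {s : ℝ}

theorem ne_target (h : IsClosedLoop G T V ε z γ a) (hs : z i s ≠ T) {t : ℝ} (ht : t ∈ Icc 0 s) :
    z i t ≠ T :=
  fun h1 => hs (h.stays i t s ht.1 ht.2 h1)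

theorem norm_velocity (v x : ℝ) : ‖(⟨v * Real.cos x, v * Real.sin x⟩ : ℂ)‖ = |v| := by
  rw [← sq_eq_sq₀ (norm_nonneg _) (abs_nonneg _), sq_abs, ← Complex.normSq_eq_norm_sq,
    Complex.normSq_mk]
  linear_combination v ^ 2 * Real.sin_sq_add_cos_sq x

theorem lipschitzOnWith_position (h : IsClosedLoop G T V ε z γ a) (hs : z i s ≠ T) :
    LipschitzOnWith ‖V i‖₊ (z i) (Icc 0 s) := by
  refine (convex_Icc 0 s).lipschitzOnWith_of_nnnorm_hasDerivWithin_le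
    (fun t ht => (h.position i t ht.1 (h.ne_target hs ht)).mono Icc_subset_Ici_self)
    fun t ht => ?_
  rw [← NNReal.coe_le_coe, coe_nnnorm, coe_nnnorm, norm_velocity, Real.norm_eq_abs]

/-- The turn rate is at most 2V/r, where r is the least distance to the target on the interval. -/
theorem lipschitzOnWith_heading (h : IsClosedLoop G T V ε z γ a) (hV : 0 < V i) (hs : z i s ≠ T) :
    ∃ K, LipschitzOnWith K (γ i) (Icc 0 s) := by
  rcases lt_or_ge s 0 with hs0 | hs0
  · exact ⟨0, by simp [Icc_eq_empty_of_lt hs0]⟩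
  have hcont : ContinuousOn (fun t => ‖T - z i t‖) (Icc 0 s) :=
    (continuousOn_const.sub (h.lipschitzOnWith_position hs).continuousOn).norm
  obtain ⟨x, hx, hmin⟩ := isCompact_Icc.exists_isMinOn ⟨s, hs0, le_rfl⟩ hcont
  have hr : 0 < ‖T - z i x‖ := norm_pos_iff.2 (sub_ne_zero.2 (h.ne_target hs hx).symm)
  set r := ‖T - z i x‖
  have hbound : ∀ t ∈ Icc 0 s, |a i t / V i| ≤ 2 * V i / r := by
    intro t ht
    rcases h.modes i t ht.1 (h.ne_target hs ht) with h1 | h1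
    · rw [h1, zero_div, abs_zero]; positivity
    · have hrt : r ≤ ‖T - z i t‖ := hmin ht
      have hR : 0 < ‖T - z i t‖ := hr.trans_le hrt
      rw [h1, arcAccel]
      have h2 : 2 * V i ^ 2 * Real.sin (leadAngle T (z i t) (γ i t)) / ‖T - z i t‖ / V i
          = 2 * V i / ‖T - z i t‖ * Real.sin (leadAngle T (z i t) (γ i t)) := by
        field_simp
      rw [h2, abs_mul, abs_of_pos (by positivity)]
      calc 2 * V i / ‖T - z i t‖ * |Real.sin (leadAngle T (z i t) (γ i t))|
          ≤ 2 * V i / r * 1 := by gcongr; exact Real.abs_sin_le_one _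
        _ = _ := mul_one _
  refine ⟨(2 * V i / r).toNNReal, LipschitzOnWith.of_dist_le_mul fun t ht u hu => ?_⟩
  have hint : ∀ t ∈ Icc 0 s, IntervalIntegrable (fun t => a i t / V i) volume 0 t := fun t ht =>
    (h.integrable i t ht.1 (h.ne_target hs ht)).div_const _
  rw [Real.coe_toNNReal _ (by positivity), h.heading i t ht.1 (h.ne_target hs ht),
    h.heading i u hu.1 (h.ne_target hs hu), dist_add_left, Real.dist_eq, Real.dist_eq,
    intervalIntegral.integral_interval_sub_left (hint t ht) (hint u hu), ← Real.norm_eq_abs]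
  refine intervalIntegral.norm_integral_le_of_norm_le_const fun x hx => hbound x ?_
  exact uIcc_subset_Icc hu ht (uIoc_subset_uIcc hx)

theorem lipschitzOnWith_bodyFrame (h : IsClosedLoop G T V ε z γ a) (hV : 0 < V i)
    (hs : z i s ≠ T) :
    ∃ K, LipschitzOnWith K (fun t => bodyFrame T (z i t) (γ i t)) (Icc 0 s) := by
  obtain ⟨K, hK⟩ := h.lipschitzOnWith_heading hV hs
  have hpair : LipschitzOnWith (max ‖V i‖₊ K) (fun t => (z i t, γ i t)) (Icc 0 s) :=
    (h.lipschitzOnWith_position hs).prodMk hK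
  have hF : ∀ t ∈ Icc 0 s, ContDiffAt ℝ 1 (fun x : ℂ × ℝ => bodyFrame T x.1 x.2) (z i t, γ i t) :=
    fun t _ => (contDiff_bodyFrame T).contDiffAt
  exact hpair.exists_comp_contDiffAt hF

theorem hasDerivAt_bodyFrame (h : IsClosedLoop G T V ε z γ a) (hs : z i s ≠ T) :
    ∀ᵐ t, t ∈ Ioo 0 s → HasDerivAt (fun t => bodyFrame T (z i t) (γ i t))
      (-V i - Complex.I * (a i t / V i : ℝ) * bodyFrame T (z i t) (γ i t)) t := by
  rcases lt_or_ge s 0 with hs0 | hs0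
  · exact Eventually.of_forall fun t ht => absurd (ht.1.trans ht.2) hs0.not_gt
  have hint : IntervalIntegrable (fun t => a i t / V i) volume 0 s :=
    (h.integrable i s hs0 hs).div_const _
  filter_upwards [hint.ae_hasDerivAt_integral] with t ht htI
  have htI' := Ioo_subset_Icc_self htI
  have h1 := ht (by rw [uIcc_of_le hs0]; exact htI') 0 left_mem_uIcc
  have hγ : HasDerivAt (γ i) (a i t / V i) t := by
    refine (h1.const_add (γ i 0)).congr_of_eventuallyEq ?_
    filter_upwards [Ioo_mem_nhds htI.1 htI.2] with u hu
    exact h.heading i u hu.1.le (h.ne_target hs (Ioo_subset_Icc_self hu))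
  have hz := (h.position i t htI.1.le (h.ne_target hs htI')).hasDerivAt (Ici_mem_nhds htI.1)
  have hexp := ((hγ.ofReal_comp.mul_const Complex.I).neg).cexp
  refine ((hz.const_sub T).mul hexp).congr_deriv ?_
  have hvel : (⟨V i * Real.cos (γ i t), V i * Real.sin (γ i t)⟩ : ℂ) =
      V i * Complex.exp (γ i t * Complex.I) := by
    rw [Complex.exp_mul_I, ← Complex.ofReal_cos, ← Complex.ofReal_sin]
    apply Complex.ext <;> simp [Complex.cos_ofReal_re, Complex.sin_ofReal_re]
  rw [hvel, bodyFrame]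
  have h2 : Complex.exp (γ i t * Complex.I) * Complex.exp (-(γ i t * Complex.I)) = 1 := by
    rw [← Complex.exp_add, add_neg_cancel, Complex.exp_zero]
  simp only [Pi.neg_apply]
  linear_combination (-(V i : ℂ)) * h2

theorem isArcOrLine (h : IsClosedLoop G T V ε z γ a) (hV : 0 < V i) (hs : z i s ≠ T) :
    IsArcOrLine (V i) s (fun t => bodyFrame T (z i t) (γ i t)) (fun t => a i t / V i) where
  speed_pos := hV
  lipschitz := h.lipschitzOnWith_bodyFrame hV hs
  ne_zero t ht := bodyFrame_ne_zero _ (h.ne_target hs ht)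
  hasDerivAt := h.hasDerivAt_bodyFrame hs
  modes t ht := by
    rcases h.modes i t ht.1 (h.ne_target hs ht) with h1 | h1
    · left; simp [h1]
    · right
      rw [h1, arcAccel_eq]
      field_simp

/-- Up to a reflection the target is to the left of the pursuer. -/
theorem exists_isArcOrLine (h : IsClosedLoop G T V ε z γ a) (hV : 0 < V i)
    (hs : z i s ≠ T) (hθ : (bodyFrame T (z i 0) (γ i 0)).im ≠ 0) :
    ∃ ζ ω, IsArcOrLine (V i) s ζ ω ∧ (ζ 0).im = |(bodyFrame T (z i 0) (γ i 0)).im| ∧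
      ∀ t ∈ Icc 0 s, ‖ζ t‖ = ‖T - z i t‖ ∧
        interceptTime T (V i) (z i t) (γ i t) = arcLength (ζ t) / V i ∧
        (a i t = 0 → ω t = 0) ∧
        (a i t = arcAccel T (V i) (z i t) (γ i t) → ω t = 2 * V i * (ζ t).im / ‖ζ t‖ ^ 2) := by
  have key := h.isArcOrLine hV hs
  rcases hθ.lt_or_gt with hneg | hpos
  · have h0 : 0 < ((starRingEnd ℂ) (bodyFrame T (z i 0) (γ i 0))).im := by simpa using hneg
    refine ⟨_, _, key.conj, by simp [abs_of_neg hneg], fun t ht => ⟨?_, ?_, ?_, ?_⟩⟩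
    · rw [RCLike.norm_conj, norm_bodyFrame]
    · have := key.conj.im_pos h0 t ht
      rw [arcLength_conj, interceptTime_eq _ _ (h.ne_target hs ht)]
      simp only [Complex.conj_im] at this
      linarith
    · intro h1; simp [h1]
    · intro h1
      rw [h1, arcAccel_eq, RCLike.norm_conj, Complex.conj_im]
      field_simp
  · refine ⟨_, _, key, by simp [abs_of_pos hpos], fun t ht => ⟨?_, ?_, ?_, ?_⟩⟩
    · rw [norm_bodyFrame]
    · rw [interceptTime_eq _ _ (h.ne_target hs ht)]
    · intro h1; simp [h1]
    · intro h1
      rw [h1, arcAccel_eq]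
      field_simp

theorem norm_le_interceptTime (h : IsClosedLoop G T V ε z γ a) (hV : 0 < V i)
    (hθ : (bodyFrame T (z i 0) (γ i 0)).im ≠ 0) (hs0 : 0 ≤ s) :
    ‖T - z i s‖ ≤ V i * interceptTime T (V i) (z i s) (γ i s) := by
  by_cases hs : z i s = T
  · simp [hs, interceptTime_target]
  obtain ⟨ζ, ω, hζ, h0, hall⟩ := h.exists_isArcOrLine hV hs hθ
  have hsI : s ∈ Icc 0 s := ⟨hs0, le_rfl⟩
  obtain ⟨h1, h2, -⟩ := hall s hsI
  rw [← h1, h2, mul_div_cancel₀ _ hV.ne']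
  exact norm_le_arcLength (hζ.im_pos (h0 ▸ abs_pos.2 hθ) s hsI)

theorem exists_lipschitzOnWith_interceptTime (h : IsClosedLoop G T V ε z γ a) (hV : 0 < V i)
    (hθ : (bodyFrame T (z i 0) (γ i 0)).im ≠ 0) (hs : z i s ≠ T) :
    ∃ L, LipschitzOnWith L (fun t => interceptTime T (V i) (z i t) (γ i t)) (Icc 0 s) := by
  obtain ⟨ζ, ω, hζ, h0, hall⟩ := h.exists_isArcOrLine hV hs hθ
  obtain ⟨K, hK⟩ := hζ.lipschitz
  obtain ⟨L, hL⟩ := hK.exists_comp_contDiffAt fun t ht =>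
    (contDiffAt_arcLength (hζ.im_pos (h0 ▸ abs_pos.2 hθ) t ht)).div_const (V i)
  refine ⟨L, fun t ht u hu => ?_⟩
  simp only
  rw [(hall t ht).2.1, (hall u hu).2.1]
  exact hL ht hu

theorem hasDerivAt_interceptTime (h : IsClosedLoop G T V ε z γ a) (hV : 0 < V i)
    (hθ : (bodyFrame T (z i 0) (γ i 0)).im ≠ 0) (hs : z i s ≠ T) :
    ∀ᵐ t, t ∈ Ioo 0 s → a i t = arcAccel T (V i) (z i t) (γ i t) →
      HasDerivAt (fun t => interceptTime T (V i) (z i t) (γ i t)) (-1) t := by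
  obtain ⟨ζ, ω, hζ, h0, hall⟩ := h.exists_isArcOrLine hV hs hθ
  filter_upwards [hζ.hasDerivAt_arcLength (h0 ▸ abs_pos.2 hθ)] with t ht htI hat
  obtain ⟨d, hd, -, hd1⟩ := ht htI
  have h1 := hd1 ((hall t (Ioo_subset_Icc_self htI)).2.2.2 hat)
  refine ((hd.div_const (V i)).congr_of_eventuallyEq ?_).congr_deriv ?_
  · filter_upwards [Ioo_mem_nhds htI.1 htI.2] with u hu
    exact (hall u (Ioo_subset_Icc_self hu)).2.1
  · rw [h1]
    field_simp

theorem interceptTime_sub_le (h : IsClosedLoop G T V ε z γ a) (hV : 0 < V i)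
    (hθ : (bodyFrame T (z i 0) (γ i 0)).im ≠ 0) (hs0 : 0 ≤ s) (hs : z i s ≠ T) :
    interceptTime T (V i) (z i 0) (γ i 0) - s ≤ interceptTime T (V i) (z i s) (γ i s) := by
  obtain ⟨ζ, ω, hζ, h0, hall⟩ := h.exists_isArcOrLine hV hs hθ
  have h1 := hζ.arcLength_add_le (h0 ▸ abs_pos.2 hθ) hs0
  rw [(hall 0 ⟨le_rfl, hs0⟩).2.1, (hall s ⟨hs0, le_rfl⟩).2.1, sub_le_iff_le_add,
    div_le_iff₀ hV, add_mul, div_mul_cancel₀ _ hV.ne']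
  linarith

/-- The estimates of all pursuers stay below the maximal one, counted down. -/
theorem interceptTime_le (h : IsClosedLoop G T V ε z γ a) (hV : ∀ i, 0 < V i)
    (hθ : ∀ i, (bodyFrame T (z i 0) (γ i 0)).im ≠ 0) {M : ℝ}
    (hM : ∀ i, interceptTime T (V i) (z i 0) (γ i 0) ≤ M) :
    ∀ t ∈ Icc 0 M, ∀ i, interceptTime T (V i) (z i t) (γ i t) ≤ M - t := by
  -- Regularity of an estimate is available only before arrival, so continuity at `t` from both
  -- sides needs a slightly later time still off the target.
  have hnear : ∀ i, ∀ t, 0 ≤ t → z i t ≠ T → ∃ u, t < u ∧ z i u ≠ T := by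
    intro i t ht hne
    have hev : ∀ᶠ u in 𝓝[>] t, z i u ≠ T :=
      (((h.continuousOn i) t ht).mono (Ioi_subset_Ici_self.trans
        (Ici_subset_Ici.2 ht))).eventually_ne hne
    obtain ⟨u, hu⟩ := (hev.and self_mem_nhdsWithin).exists
    exact ⟨u, hu.2, hu.1⟩
  have hclosed : IsClosed ({t | ∀ i, interceptTime T (V i) (z i t) (γ i t) ≤ M - t} ∩ Icc 0 M) := by
    refine isClosed_of_closure_subset fun t ht => ?_
    have htM : t ∈ Icc 0 M := closure_minimal inter_subset_right isClosed_Icc ht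
    refine ⟨fun i => ?_, htM⟩
    by_cases hti : z i t = T
    · rw [hti, interceptTime_target]; linarith [htM.2]
    obtain ⟨u, htu, hu⟩ := hnear i t htM.1 hti
    obtain ⟨L, hL⟩ :=
      h.exists_lipschitzOnWith_interceptTime (hV i) (hθ i) hu
    have hc : ContinuousWithinAt (fun t => interceptTime T (V i) (z i t) (γ i t) + t)
        ({t | ∀ i, interceptTime T (V i) (z i t) (γ i t) ≤ M - t} ∩ Icc 0 M) t := by
      refine ContinuousWithinAt.add ?_ continuousWithinAt_id
      refine (hL.continuousOn t ⟨htM.1, htu.le⟩).mono_of_mem_nhdsWithin ?_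
      filter_upwards [self_mem_nhdsWithin,
        mem_nhdsWithin_of_mem_nhds (Iio_mem_nhds htu)] with x hx hx'
      exact ⟨hx.2.1, le_of_lt hx'⟩
    have := closure_minimal (s := Iic M) (fun x hx => hx) isClosed_Iic
      (hc.mem_closure ht (t := Iic M) fun x hx => by
        have := hx.1 i
        simp only [mem_Iic]
        linarith)
    simp only [mem_Iic] at this
    linarith
  intro t ht
  -- Continuous induction in time: arrivals may interrupt the regularity of the estimates, so the
  -- bound is extended over short intervals on which nobody new arrives.
  refine hclosed.Icc_subset_of_forall_exists_gt (by simpa using hM) ?_ ht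
  rintro x ⟨hx, hx0, hxM⟩ y hy
  have hchoice : ∃ w, x < w ∧ ∀ i, z i x ≠ T → z i w ≠ T := by
    have hev : ∀ᶠ u in 𝓝[>] x, ∀ i, z i x ≠ T → z i u ≠ T := by
      rw [eventually_all]
      intro i
      rw [eventually_imp_distrib_left]
      exact (((h.continuousOn i) x hx0).mono (Ioi_subset_Ici_self.trans
        (Ici_subset_Ici.2 hx0))).eventually_ne
    obtain ⟨u, hu⟩ := (hev.and self_mem_nhdsWithin).exists
    exact ⟨u, hu.2, hu.1⟩
  obtain ⟨w, hxw, hw⟩ := hchoice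
  have hy : x < y := hy
  let u := min w (min y M)
  have hxu : x < u := lt_min hxw (lt_min hy hxM)
  have hu0 : 0 ≤ u := hx0.trans hxu.le
  have huM : u ≤ M := (min_le_right _ _).trans (min_le_right _ _)
  have hu : ∀ i, z i x ≠ T → z i u ≠ T := fun i hi =>
    h.ne_target (hw i hi) ⟨hu0, min_le_left _ _⟩
  refine ⟨u, ?_, hxu, (min_le_right _ _).trans (min_le_left _ _)⟩
  classical
  -- Pursuers already at the target get the harmless value 0, which never exceeds `M`.
  let D : Fin n → ℝ → ℝ := fun i t =>
    if z i x = T then 0 else interceptTime T (V i) (z i t) (γ i t) + t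
  have hD : ∀ i, ∃ K, LipschitzOnWith K (D i) (Icc x u) := by
    intro i
    by_cases hi : z i x = T
    · simp only [D, if_pos hi]
      exact ⟨0, (LipschitzWith.const 0).lipschitzOnWith⟩
    · simp only [D, if_neg hi]
      obtain ⟨L, hL⟩ := h.exists_lipschitzOnWith_interceptTime (hV i) (hθ i) (hu i hi)
      exact ⟨L + 1, (hL.mono (Icc_subset_Icc_left hx0)).add LipschitzWith.id.lipschitzOnWith⟩
  choose K hK using hD
  have hD0 : ∀ i, D i x ≤ M := by
    intro i
    by_cases hi : z i x = T
    · simp only [D, if_pos hi]; linarith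
    · simp only [D, if_neg hi]; linarith [hx i]
  have hae : ∀ᵐ t, ∀ i, z i x ≠ T → t ∈ Ioo 0 u → a i t = arcAccel T (V i) (z i t) (γ i t) →
      HasDerivAt (fun t => interceptTime T (V i) (z i t) (γ i t)) (-1) t := by
    rw [ae_all_iff]
    intro i
    by_cases hi : z i x = T
    · exact Eventually.of_forall fun t h1 => absurd hi h1
    · filter_upwards [h.hasDerivAt_interceptTime (hV i) (hθ i) (hu i hi)] with t ht _
      exact ht
  have key := LipschitzOnWith.forall_le_of_ae_deriv_nonpos hxu.le hK (c := M) (by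
    filter_upwards [hae] with t ht htI i hi hmax
    have ht0 : 0 < t := hx0.trans_lt htI.1
    have hix : z i x ≠ T := by
      intro hix
      simp only [D, if_pos hix] at hi
      linarith
    have hit : z i t ≠ T := h.ne_target (hu i hix) ⟨ht0.le, htI.2.le⟩
    have hDi : D i = fun t => interceptTime T (V i) (z i t) (γ i t) + t := by
      funext t
      simp only [D, if_neg hix]
    rw [hDi] at hi hmax ⊢
    -- A maximal `D i` above `M` dominates all out-neighbours, including arrived ones with estimate
    -- 0, so `i` is on its arc and `D i` is stationary.
    have harc := ht i hix ⟨ht0, htI.2⟩ (h.arc i t ht0.le hit fun j _ => by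
      by_cases hj : z j x = T
      · have hjt : z j t = T := h.stays j x t hx0 htI.1.le hj
        rw [hjt, interceptTime_target]
        linarith [htI.2]
      · have := hmax j
        simp only [D, if_neg hj] at this
        linarith)
    rw [HasDerivAt.deriv (f := fun t => interceptTime T (V i) (z i t) (γ i t) + t)
      (harc.add (hasDerivAt_id t))]
    norm_num) hD0
  intro i
  by_cases hi : z i x = T
  · rw [h.stays i x u hx0 hxu.le hi, interceptTime_target]
    linarith
  · have := key i
    simp only [D, if_neg hi] at this
    linarith

end IsClosedLoop

/-! ### Distance bounds uniform in the tolerance, and the limit -/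

/-- A pursuer that moves on a straight line whenever its estimate is less than `c`, and whose
estimate is bounded, keeps a distance from the target that depends only on its initial pose. -/
theorem exists_le_norm_of_straight {n : ℕ} {G : Digraph (Fin n)} {T : ℂ} {V : Fin n → ℝ}
    {i : Fin n} (hV : 0 < V i) {z₀ : ℂ} {γ₀ : ℝ} (hz₀ : z₀ ≠ T) (hθ : (bodyFrame T z₀ γ₀).im ≠ 0)
    (M : ℝ) {c : ℝ} (hc : 0 < c) :
    ∃ β, 0 < β ∧ ∀ ε z γ a, IsClosedLoop G T V ε z γ a → z i 0 = z₀ → γ i 0 = γ₀ → ∀ s,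
      (∀ t ∈ Icc 0 s, z i t ≠ T → interceptTime T (V i) (z i t) (γ i t) ≤ M ∧
        (interceptTime T (V i) (z i t) (γ i t) < c → a i t = 0)) →
      ∀ t ∈ Icc 0 s, β ≤ ‖T - z i t‖ := by
  have hpi := Real.pi_pos
  set q := |(bodyFrame T z₀ γ₀).im| with hq
  have hq0 : 0 < q := abs_pos.2 hθ
  have hR0 : 0 < ‖T - z₀‖ := norm_pos_iff.2 (sub_ne_zero.2 hz₀.symm)
  -- `W` bounds the arc diameter by its initial value and the threshold of `diam_le`; `β` is the
  -- offset bound of `le_im`.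
  set W := max (‖T - z₀‖ ^ 2 / q) (2 * V i * M / Real.pi)
  have hW : 0 < W := lt_max_of_lt_left (by positivity)
  set β := min ((2 * V i * c / Real.pi) ^ 2 / W) q
  have hβ : 0 < β := lt_min (by positivity) hq0
  refine ⟨β, hβ, fun ε z γ a h hz hγ s hs t ht => ?_⟩
  have hθ' : (bodyFrame T (z i 0) (γ i 0)).im ≠ 0 := by rwa [hz, hγ]
  have hdich : ∀ u ∈ Icc 0 t, z i u ≠ T → β ≤ ‖T - z i u‖ := by
    intro u hu hne
    obtain ⟨ζ, ω, hζ, h0, hall⟩ := h.exists_isArcOrLine hV hne hθ'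
    rw [hz, hγ, ← hq] at h0
    have hu' : u ∈ Icc 0 u := ⟨hu.1, le_rfl⟩
    have hsub : ∀ x ∈ Icc 0 u, x ∈ Icc 0 s := fun x hx =>
      ⟨hx.1, hx.2.trans (hu.2.trans ht.2)⟩
    have hn0 : ‖ζ 0‖ = ‖T - z₀‖ := by rw [(hall 0 ⟨le_rfl, hu.1⟩).1, hz]
    have key := hζ.le_im (h0 ▸ hq0) (M := M) (W := W) (c := c) (β := β) hc.le
      (fun x hx => by
        have := (hs x (hsub x hx) (h.ne_target hne hx)).1
        rw [(hall x hx).2.1, div_le_iff₀ hV] at this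
        linarith)
      (by rw [hn0, h0]; exact le_max_left _ _) (le_max_right _ _)
      (fun x hx hlt => (hall x hx).2.2.1 ((hs x (hsub x hx) (h.ne_target hne hx)).2 (by
        rw [(hall x hx).2.1, div_lt_iff₀ hV]
        linarith)))
      (min_le_left _ _) (h0 ▸ min_le_right _ _) u hu'
    rw [← (hall u hu').1]
    exact key.trans (Complex.im_le_norm _)
  -- The bound holds as long as the target is not reached. Reaching it would make the distance pass
  -- through β/2 beforehand, by continuity.
  by_contra hlt
  have hT : z i t = T := by
    by_contra hne
    exact hlt (hdich t ⟨ht.1, le_rfl⟩ hne)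
  have h0 : β ≤ ‖T - z i 0‖ := hdich 0 ⟨le_rfl, ht.1⟩ (by rwa [hz])
  have hcont : ContinuousOn (fun u => ‖T - z i u‖) (Icc 0 t) :=
    (continuousOn_const.sub ((h.continuousOn i).mono Icc_subset_Ici_self)).norm
  obtain ⟨u, hu, hu2⟩ := intermediate_value_Icc' ht.1 hcont (show β / 2 ∈ Icc _ _ by
    simp only [hT, sub_self, norm_zero]
    exact ⟨by positivity, by linarith⟩)
  simp only at hu2
  have hne : z i u ≠ T := by
    intro h1
    rw [h1, sub_self, norm_zero] at hu2
    linarith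
  have := hdich u hu hne
  linarith

theorem mainTheorem1 (n : ℕ) (G : Digraph (Fin n)) (T : ℂ) (V : Fin n → ℝ) (hV : ∀ i, 0 < V i)
    (z : Fin n → ℝ → ℂ) (γ : Fin n → ℝ → ℝ) (htraj : IsGuidedTrajectory G T V z γ)
    (hpos : ∀ i, z i 0 ≠ T)
    (hθ : ∀ i, leadAngle T (z i 0) (γ i 0) ≠ 0 ∧ leadAngle T (z i 0) (γ i 0) ≠ Real.pi)
    (l : Fin n) (hlead : IsLeader T V (fun i => z i 0) (fun i => γ i 0) l)
    (hreach : GloballyReachable G l) :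
    ∀ i, (∀ t, 0 ≤ t → t < interceptTime T (V l) (z l 0) (γ l 0) → z i t ≠ T) ∧
      z i (interceptTime T (V l) (z l 0) (γ l 0)) = T := by
  obtain ⟨ε, zk, γk, ak, hε0, hε, hloop, hinit, hzlim, -⟩ := htraj
  set M := interceptTime T (V l) (z l 0) (γ l 0) with hM
  have him : ∀ i, (bodyFrame T (z i 0) (γ i 0)).im ≠ 0 := fun i => im_bodyFrame_ne_zero (hθ i)
  have himk : ∀ k i, (bodyFrame T (zk k i 0) (γk k i 0)).im ≠ 0 := by
    intro k i
    rw [(hinit k i).1, (hinit k i).2]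
    exact him i
  have hle : ∀ k, ∀ t ∈ Icc 0 M, ∀ i,
      interceptTime T (V i) (zk k i t) (γk k i t) ≤ M - t := fun k =>
    (hloop k).interceptTime_le hV (himk k) fun i => by
      rw [(hinit k i).1, (hinit k i).2]
      exact hlead i
  have hM0 : 0 < M := by
    have h1 := (hloop 0).norm_le_interceptTime (hV l) (himk 0 l) le_rfl
    rw [(hinit 0 l).1, (hinit 0 l).2, ← hM] at h1
    have h2 : 0 < ‖T - z l 0‖ := norm_pos_iff.2 (sub_ne_zero.2 (hpos l).symm)
    exact pos_of_mul_pos_right (h2.trans_le h1) (hV l).le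
  have hlimpt : ∀ i t, 0 ≤ t → Tendsto (fun k => zk k i t) atTop (𝓝 (z i t)) := fun i t ht =>
    (hzlim i t ht).tendsto_at ⟨ht, le_rfl⟩
  have hfar : ∀ i, ∀ s, 0 ≤ s → s < M → ∃ β, 0 < β ∧ ∀ᶠ k in atTop, ∀ t ∈ Icc 0 s,
      β ≤ ‖T - zk k i t‖ := by
    intro i
    induction hreach i using Relation.ReflTransGen.head_induction_on with
    | refl =>
      intro s hs0 hsM
      -- With the threshold M - s the straight-flight condition is vacuous up to time `s`, since the
      -- leader's estimate is at least M - t.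
      obtain ⟨β, hβ, hall⟩ := exists_le_norm_of_straight (G := G) (hV l) (hpos l) (him l) M
        (sub_pos.2 hsM)
      refine ⟨β, hβ, Eventually.of_forall fun k => hall (ε k) (zk k) (γk k) (ak k) (hloop k)
        (hinit k l).1 (hinit k l).2 s fun t ht hne => ⟨?_, fun hlt => ?_⟩⟩
      · linarith [hle k t ⟨ht.1, ht.2.trans hsM.le⟩ l, ht.1]
      · have := (hloop k).interceptTime_sub_le (hV l) (himk k l) ht.1 hne
        rw [(hinit k l).1, (hinit k l).2, ← hM] at this
        linarith [ht.2]
    | @head i j hij _ ih =>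
      intro s hs0 hsM
      obtain ⟨β, hβ, hall⟩ := ih s hs0 hsM
      -- Half of the lower bound β / V_j for the estimate of `j` serves as threshold for `i`; the
      -- other half absorbs the tolerance.
      have hc : 0 < β / (2 * V j) := div_pos hβ (mul_pos two_pos (hV j))
      obtain ⟨β', hβ', hall'⟩ := exists_le_norm_of_straight (G := G) (hV i) (hpos i) (him i) M hc
      refine ⟨β', hβ', ?_⟩
      filter_upwards [hall, hε.eventually_lt_const hc] with k hk hεk
      refine hall' (ε k) (zk k) (γk k) (ak k) (hloop k) (hinit k i).1 (hinit k i).2 s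
        fun t ht hne => ⟨?_, fun hlt => ?_⟩
      · linarith [hle k t ⟨ht.1, ht.2.trans hsM.le⟩ i, ht.1]
      · refine (hloop k).straight i t ht.1 hne ⟨j, hij, ?_⟩
        have h1 := (hk t ht).trans ((hloop k).norm_le_interceptTime (hV j) (himk k j) ht.1)
        rw [← div_le_iff₀' (hV j)] at h1
        have h2 : β / (2 * V j) + β / (2 * V j) = β / V j := by
          have := (hV j).ne'
          field_simp
          norm_num
        linarith
  intro i
  refine ⟨fun t ht htM hT => ?_, ?_⟩
  · obtain ⟨β, hβ, hall⟩ := hfar i t ht htM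
    have h1 := ge_of_tendsto ((tendsto_const_nhds.sub (hlimpt i t ht)).norm)
      (hall.mono fun k hk => hk t ⟨ht, le_rfl⟩)
    rw [hT, sub_self, norm_zero] at h1
    linarith
  · refine tendsto_nhds_unique (hlimpt i M hM0.le) (tendsto_const_nhds.congr fun k => ?_)
    have h1 := hle k M ⟨hM0.le, le_rfl⟩ i
    have h2 := (hloop k).norm_le_interceptTime (hV i) (himk k i) hM0.le
    have h3 : ‖T - zk k i M‖ ≤ 0 := by nlinarith [hV i]
    exact sub_eq_zero.1 (norm_le_zero_iff.1 h3)
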